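/- Let $k$ be an algebraically closed field of characteristic $0$, let $\mathbf{F}$ be a finite field with $q$ elements, and let $n, m \ge 0$ be integers. Write $\mathfrak{M}_n$ for the multiplicative monoid of $n \times n$ matrices over $\mathbf{F}$, $k[\mathfrak{M}_n]$ for its monoid algebra, and $\mathfrak{G}_r = \mathrm{GL}_r(\mathbf{F})$. Let $V = k[\mathbf{F}^n]$ be the permutation module of $\mathfrak{M}_n$ (the $k$-vector space with basis $\mathbf{F}^n$, on which a matrix acts by $[x] \mapsto [ax]$), and let $\mathfrak{M}_n$ act diagonally on $V^{\otimes m}$. For each $r$-dimensional subspace $U$ of $\mathbf{F}^n$ fix a linear isomorphism $f_U \colon \mathbf{F}^r \to U$. For an irreducible $k$-linear representation $\pi \colon \mathfrak{G}_r \to \mathrm{GL}(W)$, let $L_n(\pi)$ be the $k[\mathfrak{M}_n]$-module with underlying space $W \otimes_k k^{N}$, where $k^N$ has a basis $(u_U)$ indexed by the $r$-dimensional subspaces $U \subseteq \mathbf{F}^n$, and where $a \in \mathfrak{M}_n$ acts by $$ a \cdot (w \otimes u_U) = \begin{cases} \pi(f_{a(U)}^{-1}\, a\, f_U)\, w \otimes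 u_{a(U)} & \text{if } \dim a(U) = r, \\ 0 & \text{otherwise.} \end{cases} $$ Then there is an isomorphism of $k[\mathfrak{M}_n]$-modules $$ V^{\otimes m} \;\cong\; \bigoplus_{r=0}^{\min(n,m)} \ \bigoplus_{\pi} \ L_n(\pi)^{\oplus \mathbf{m}(\pi)}, $$ where $\pi$ runs over the isomorphism classes of irreducible $k$-linear representations of $\mathfrak{G}_r$, and $$ \mathbf{m}(\pi) = \dim_k L_m(\pi) = \binom{m}{r}_{\!q} \cdot \dim_k \pi . $$ Here $\binom{m}{r}_q = \dfrac{[m]_q!}{[r]_q!\,[m-r]_q!}$ with $[i]_q = 1 + q + \cdots + q^{i-1}$ and $[i]_q! = [i]_q [i-1]_q \cdots [1]_q$. -/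

import Mathlib

open scoped TensorProduct DirectSum

noncomputable section

/-! ### `q`-binomial coefficients -/

/-- The `q`-integer `[n]_q = 1 + q + ⋯ + q^(n-1)`. -/
def qInt (q : ℚ) (n : ℕ) : ℚ := ∑ i ∈ Finset.range n, q ^ i

/-- The `q`-factorial `[n]_q! = [n]_q [n-1]_q ⋯ [1]_q`. -/
def qFactorial (q : ℚ) (n : ℕ) : ℚ := ∏ i ∈ Finset.range n, qInt q (i + 1)

/-- The `q`-binomial coefficient `[n choose m]_q`, for `m ≤ n`. -/
def qBinom (q : ℚ) (n m : ℕ) : ℚ :=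
  qFactorial q n / (qFactorial q m * qFactorial q (n - m))

/-! ### Irreducible representations up to isomorphism -/

/-- An irreducible representation of `G` over `k`. (For a finite group `G` every irreducible
representation is finite-dimensional, hence isomorphic to one on a space in the universe of `k`.) -/
structure IrrRep.{u, v} (k : Type u) [Field k] (G : Type v) [Group G] where
  /-- The underlying vector space. -/
  V : Type u
  [addCommGroup : AddCommGroup V]
  [module : Module k V]
  /-- The action of `G`. -/
  ρ : Representation k G V
  irreducible : ρ.IsIrreducible

attribute [instance] IrrRep.addCommGroup IrrRep.module

/-- Isomorphism of irreducible representations, as an equivalence relation. -/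
instance IrrRep.isoSetoid (k : Type*) [Field k] (G : Type*) [Group G] : Setoid (IrrRep k G) where
  r π σ := Nonempty (π.ρ.Equiv σ.ρ)
  iseqv :=
    { refl := fun π => ⟨Representation.Equiv.refl π.ρ⟩
      symm := fun ⟨e⟩ => ⟨e.symm⟩
      trans := fun ⟨e⟩ ⟨f⟩ => ⟨e.trans f⟩ }

/-- The set of isomorphism classes of irreducible representations of `G` over `k`. -/
def IrrClass (k : Type*) [Field k] (G : Type*) [Group G] := Quotient (IrrRep.isoSetoid k G)

/-- A representative of an isomorphism class. -/
def IrrClass.rep {k : Type*} [Field k] {G : Type*} [Group G] (c : IrrClass k G) : IrrRep k G :=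
  Quotient.out c

/-! ### The modules `L_n(π)` -/

section Subspaces

variable (F : Type*) [Field F]

/-- The set of `r`-dimensional subspaces of `F^n`. -/
abbrev Subspaces (n r : ℕ) := {U : Submodule F (Fin n → F) // Module.finrank F U = r}

variable {F} {n r : ℕ}

/-- A fixed isomorphism `f_U : F^r → U` for every `r`-dimensional subspace `U` of `F^n`. -/
def subspaceFrame (U : Subspaces F n r) : (Fin r → F) ≃ₗ[F] U.1 :=
  LinearEquiv.ofFinrankEq _ _ (by rw [Module.finrank_fin_fun, U.2])

/-- The image `m(U)` of a subspace `U` of `F^n` under a matrix `m`. -/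
abbrev subspaceImage (m : Matrix (Fin n) (Fin n) F) (U : Submodule F (Fin n → F)) :
    Submodule F (Fin n → F) :=
  U.map m.mulVecLin

/-- For `r`-dimensional `U` and `W = m(U)`, the matrix `m` restricts to an isomorphism `U → W`. -/
def restrictEquiv (m : Matrix (Fin n) (Fin n) F) (U W : Subspaces F n r)
    (h : subspaceImage m U.1 = W.1) : U.1 ≃ₗ[F] W.1 :=
  LinearEquiv.ofBijective
    (m.mulVecLin.restrict (p := U.1) (q := W.1) fun _ hx => h ▸ Submodule.mem_map_of_mem hx) (by
      have hs : Function.Surjective (m.mulVecLin.restrict (p := U.1) (q := W.1)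
          fun _ hx => h ▸ Submodule.mem_map_of_mem hx) := by
        rintro ⟨y, hy⟩
        rw [← h] at hy
        obtain ⟨x, hx, rfl⟩ := hy
        exact ⟨⟨x, hx⟩, rfl⟩
      exact ⟨(LinearMap.injective_iff_surjective_of_finrank_eq_finrank (U.2.trans W.2.symm)).2 hs,
        hs⟩)

/-- The element `f_W⁻¹ ∘ m ∘ f_U` of `GL_r(F)`, for `r`-dimensional `U` and `W = m(U)`. -/
def transition (m : Matrix (Fin n) (Fin n) F) (U W : Subspaces F n r)
    (h : subspaceImage m U.1 = W.1) : GL (Fin r) F :=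
  Matrix.GeneralLinearGroup.toLin.symm (LinearMap.GeneralLinearGroup.ofLinearEquiv
    ((subspaceFrame U).trans ((restrictEquiv m U W h).trans (subspaceFrame W).symm)))

theorem subspaceFrame_transition (m : Matrix (Fin n) (Fin n) F) (U W : Subspaces F n r)
    (h : subspaceImage m U.1 = W.1) (x : Fin r → F) :
    (subspaceFrame W ((transition m U W h).1.mulVec x) : Fin n → F) = m.mulVec (subspaceFrame U x) := by
  have h1 : (transition m U W h).1.mulVec x =
      (subspaceFrame W).symm (restrictEquiv m U W h (subspaceFrame U x)) := by
    have : Matrix.GeneralLinearGroup.toLin (transition m U W h) =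
      LinearMap.GeneralLinearGroup.ofLinearEquiv
        ((subspaceFrame U).trans ((restrictEquiv m U W h).trans (subspaceFrame W).symm)) :=
      MulEquiv.apply_symm_apply _ _
    have h2 := congrArg (fun g => (g : (Fin r → F) →ₗ[F] (Fin r → F)) x)
      (congrArg Units.val this)
    simpa using h2
  rw [h1, LinearEquiv.apply_symm_apply]
  rfl

theorem transition_eq_of (m : Matrix (Fin n) (Fin n) F) (U W : Subspaces F n r)
    (h : subspaceImage m U.1 = W.1) (g : GL (Fin r) F)
    (hg : ∀ x, (subspaceFrame W (g.1.mulVec x) : Fin n → F) = m.mulVec (subspaceFrame U x)) :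
    transition m U W h = g := by
  apply Units.ext
  apply Matrix.ext_of_mulVec_single
  intro i
  apply (subspaceFrame W).injective
  apply Subtype.ext
  rw [subspaceFrame_transition, hg]

theorem transition_one (U : Subspaces F n r) (h : subspaceImage 1 U.1 = U.1) :
    transition 1 U U h = 1 :=
  transition_eq_of _ _ _ _ _ (by simp)

theorem transition_mul (a b : Matrix (Fin n) (Fin n) F) (U W X : Subspaces F n r)
    (hb : subspaceImage b U.1 = W.1) (ha : subspaceImage a W.1 = X.1) (h : subspaceImage (a * b) U.1 = X.1) :
    transition (a * b) U X h = transition a W X ha * transition b U W hb :=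
  transition_eq_of _ _ _ _ _ fun x => by
    rw [Units.val_mul, ← Matrix.mulVec_mulVec, subspaceFrame_transition, subspaceFrame_transition,
      Matrix.mulVec_mulVec]

theorem subspaceImage_mul (a b : Matrix (Fin n) (Fin n) F) (U : Submodule F (Fin n → F)) :
    subspaceImage (a * b) U = subspaceImage a (subspaceImage b U) := by
  simp only [subspaceImage, Matrix.mulVecLin_mul, Submodule.map_comp]

theorem subspaceImage_one (U : Submodule F (Fin n → F)) : subspaceImage 1 U = U := by
  simp [subspaceImage]

end Subspaces

section LModule

variable {k : Type*} [Field k] {F : Type*} [Field F] [Finite F]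

instance (n r : ℕ) : Finite (Subspaces F n r) := by
  have : Finite (Submodule F (Fin n → F)) :=
    Finite.of_injective (fun U => (U : Set (Fin n → F))) SetLike.coe_injective
  infer_instance

instance (n r : ℕ) : Fintype (Subspaces F n r) := Fintype.ofFinite _

/-- The underlying space `V ⊗ k^N` of `L_n(π)`, where `V` is the space of `π` and `k^N` has a basis
indexed by the `r`-dimensional subspaces of `F^n`. -/
abbrev LSpace {r : ℕ} (n : ℕ) (π : IrrRep k (GL (Fin r) F)) :=
  π.V ⊗[k] (Subspaces F n r →₀ k)

open Classical in
/-- The operator by which a matrix `m` acts on `L_n(π)`, namely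
`∑ π(f_W⁻¹ m f_U) ⊗ E_{W,U}`, the sum being over the `r`-dimensional subspaces `U` for which
`W = m(U)` is again `r`-dimensional. Here `E_{W,U}` is the elementary matrix that sends the basis
vector of `U` to that of `W`. -/
def LAction {r : ℕ} (n : ℕ) (π : IrrRep k (GL (Fin r) F)) (m : Matrix (Fin n) (Fin n) F) :
    LSpace n π →ₗ[k] LSpace n π :=
  ∑ U : Subspaces F n r,
    if h : Module.finrank F (subspaceImage m U.1) = r then
      TensorProduct.map (π.ρ (transition m U ⟨subspaceImage m U.1, h⟩ rfl))
        (Finsupp.lsingle (⟨subspaceImage m U.1, h⟩ : Subspaces F n r) ∘ₗ Finsupp.lapply U)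
    else 0

theorem LAction_single {r n : ℕ} (π : IrrRep k (GL (Fin r) F)) (m : Matrix (Fin n) (Fin n) F)
    (v : π.V) (U W : Subspaces F n r) (h : subspaceImage m U.1 = W.1) (c : k) :
    LAction n π m (v ⊗ₜ Finsupp.single U c) =
      π.ρ (transition m U W h) v ⊗ₜ Finsupp.single W c := by
  obtain ⟨W, hW⟩ := W
  dsimp only at h
  subst h
  rw [LAction, LinearMap.sum_apply, Finset.sum_eq_single U]
  · rw [dif_pos hW]
    simp
  · intro X _ hX
    split_ifs
    · simp [Ne.symm hX]
    · rfl
  · simp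

theorem LAction_single_of_ne {r n : ℕ} (π : IrrRep k (GL (Fin r) F))
    (m : Matrix (Fin n) (Fin n) F) (v : π.V) (U : Subspaces F n r)
    (h : Module.finrank F (subspaceImage m U.1) ≠ r) (c : k) :
    LAction n π m (v ⊗ₜ Finsupp.single U c) = 0 := by
  rw [LAction, LinearMap.sum_apply]
  refine Finset.sum_eq_zero fun X _ => ?_
  split_ifs with hX
  · have : U ≠ X := by rintro rfl; exact h hX
    simp [this]
  · rfl

/-- The module `L_n(π)` of the monoid `M_n(F)`. -/
def LRep {r : ℕ} (n : ℕ) (π : IrrRep k (GL (Fin r) F)) :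
    Representation k (Matrix (Fin n) (Fin n) F) (LSpace n π) where
  toFun := LAction n π
  map_one' := by
    refine TensorProduct.ext' fun v x => ?_
    induction x using Finsupp.induction_linear with
    | zero => simp
    | add x y hx hy => rw [TensorProduct.tmul_add, map_add, map_add, hx, hy]
    | single U c => rw [LAction_single π 1 v U U (subspaceImage_one _), transition_one]; simp
  map_mul' a b := by
    refine TensorProduct.ext' fun v x => ?_
    induction x using Finsupp.induction_linear with
    | zero => simp
    | add x y hx hy => rw [TensorProduct.tmul_add, map_add, map_add, hx, hy]
    | single U c =>
      rw [Module.End.mul_apply]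
      by_cases hb : Module.finrank F (subspaceImage b U.1) = r
      · rw [LAction_single π b v U ⟨_, hb⟩ rfl]
        by_cases ha : Module.finrank F (subspaceImage a (subspaceImage b U.1)) = r
        · rw [LAction_single π a _ ⟨_, hb⟩ ⟨_, ha⟩ rfl,
            LAction_single π (a * b) v U ⟨_, ha⟩ (subspaceImage_mul a b U.1),
            transition_mul a b U ⟨_, hb⟩ ⟨_, ha⟩ rfl rfl, map_mul, Module.End.mul_apply]
        · rw [LAction_single_of_ne π a _ ⟨_, hb⟩ ha, LAction_single_of_ne]
          rwa [subspaceImage_mul]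
      · rw [LAction_single_of_ne π b v U hb, map_zero, LAction_single_of_ne]
        intro h
        apply hb
        refine le_antisymm ?_ ?_
        · exact (Submodule.finrank_map_le _ _).trans U.2.le
        · rw [subspaceImage_mul] at h
          exact h.symm.le.trans (Submodule.finrank_map_le _ _)

end LModule

/-! ### Tensor powers of the basic permutation module -/

section TensorPower

variable (k : Type*) [Field k] (F : Type*) [Field F]

/-- The basic permutation representation `V = k[F^n]` of the monoid `M_n(F)`, which acts on the
set `F^n` by matrix-vector multiplication. -/
abbrev basicRep (n : ℕ) :
    Representation k (Matrix (Fin n) (Fin n) F) (MonoidAlgebra k (Fin n → F)) :=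
  Representation.ofMulAction k (Matrix (Fin n) (Fin n) F) (Fin n → F)

/-- The `m`-th tensor power `V^{⊗m}`, on which a matrix `a` acts as `a ⊗ ⋯ ⊗ a`. -/
def tensorPowerRep (n m : ℕ) :
    Representation k (Matrix (Fin n) (Fin n) F) (⨂[k] _ : Fin m, MonoidAlgebra k (Fin n → F)) where
  toFun a := PiTensorProduct.map fun _ => basicRep k F n a
  map_one' := by simp only [map_one]; exact PiTensorProduct.map_one
  map_mul' a b := by simp only [map_mul]; exact PiTensorProduct.map_mul _ _

end TensorPower

end

/-! Reading the tensor factors as columns identifies `V^{⊗m}` with `k[Mat_{n,m}]`, on which a matrix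
acts by left multiplication (`tensorPowerRep_repr_symm`). A matrix of rank `r` is uniquely `A_W g
A_Uᵀ`, with `W ⊆ F^n` its column space, `U ⊆ F^m` its row space, `A_W`, `A_U` their frames and `g ∈
GL_r`. For fixed `U`, these matrices would span copies of the `L_n(π)` if a drop in rank gave zero.

To enforce this, one inserts an element `ε_r` of `k[Mat_r]` that is `1` modulo singular matrices and
is killed on the left by every matrix of rank below `r` (`exists_isTopElement`). By the Fourier
transform, the elements killed by such matrices include the inverse transforms of all functions
supported on `GL_r`, a space of dimension `|GL_r|`. Restricting these elements to their coefficients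
on `GL_r` is injective (`eq_zero_of_singular`, by induction on `r`), hence surjective, and `ε_r` is
the preimage of the delta function at `1`.

Given an equivariant `j : π → k[GL_r]`, the map `w ⊗ u_W ↦ A_W j(w) ε_r A_Uᵀ` is a module map from
`L_n(π)` (`LEmbedding_LAction`). There are `dim π` independent choices of `j`, by the decomposition
of `k[GL_r]` into matrix algebras, and one for each `U`, which makes `dim L_m(π)` copies. Together
they are surjective, because `A_W g ε_r A_Uᵀ` equals `A_W g A_Uᵀ` up to lower rank. Counting
dimensions, with `∑ (dim π)² = |GL_r|`, gives bijectivity. -/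

noncomputable section

/-! ### The linearised matrix product -/

section Conv

variable {k : Type*} [Field k] {F : Type*} [Field F]

/-- The `k`-bilinear extension `k[Mat_{a,b}] × k[Mat_{b,c}] → k[Mat_{a,c}]` of the matrix product. -/
def conv {a b c : ℕ} : (Matrix (Fin a) (Fin b) F →₀ k) →ₗ[k] (Matrix (Fin b) (Fin c) F →₀ k) →ₗ[k]
    (Matrix (Fin a) (Fin c) F →₀ k) :=
  Finsupp.linearCombination k fun x => Finsupp.lmapDomain k k fun y => x * y

/-- The basis element of `k[Mat_{a,b}]` given by a matrix. -/
abbrev matSingle (k : Type*) [Field k] {F : Type*} {a b : ℕ} (x : Matrix (Fin a) (Fin b) F) :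
    Matrix (Fin a) (Fin b) F →₀ k := Finsupp.single x 1

variable {a b c d : ℕ}

theorem conv_single_single (x : Matrix (Fin a) (Fin b) F) (y : Matrix (Fin b) (Fin c) F) (s t : k) :
    conv (Finsupp.single x s) (Finsupp.single y t) = Finsupp.single (x * y) (s * t) := by
  simp [conv]

theorem conv_matSingle_left (x : Matrix (Fin a) (Fin b) F) (f : Matrix (Fin b) (Fin c) F →₀ k) :
    conv (matSingle k x) f = Finsupp.mapDomain (fun y => x * y) f := by
  simp [conv]

theorem conv_eq_sum (f : Matrix (Fin a) (Fin b) F →₀ k) (g : Matrix (Fin b) (Fin c) F →₀ k) :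
    conv f g = f.sum fun x s => s • conv (matSingle k x) g := by
  simp [conv, Finsupp.linearCombination_apply, Finsupp.sum, LinearMap.sum_apply]

theorem conv_assoc (f : Matrix (Fin a) (Fin b) F →₀ k) (g : Matrix (Fin b) (Fin c) F →₀ k)
    (h : Matrix (Fin c) (Fin d) F →₀ k) : conv (conv f g) h = conv f (conv g h) := by
  induction f using Finsupp.induction_linear with
  | zero => simp
  | add f f' hf hf' => simp [hf, hf']
  | single x s =>
    induction g using Finsupp.induction_linear with
    | zero => simp
    | add g g' hg hg' => simp only [map_add, LinearMap.add_apply, hg, hg']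
    | single y t =>
      induction h using Finsupp.induction_linear with
      | zero => simp
      | add h h' hh hh' => simp only [map_add, hh, hh']
      | single z u => simp only [conv_single_single, Matrix.mul_assoc, mul_assoc]

theorem conv_matSingle_right (f : Matrix (Fin a) (Fin b) F →₀ k) (y : Matrix (Fin b) (Fin c) F) :
    conv f (matSingle k y) = Finsupp.mapDomain (fun x => x * y) f := by
  induction f using Finsupp.induction_linear with
  | zero => simp
  | add f f' hf hf' => simp [Finsupp.mapDomain_add, hf, hf']
  | single x s => rw [conv_single_single, Finsupp.mapDomain_single, mul_one]

@[simp]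
theorem one_conv (f : Matrix (Fin a) (Fin b) F →₀ k) : conv (matSingle k 1) f = f := by
  simp only [conv_matSingle_left, Matrix.one_mul]
  exact Finsupp.mapDomain_id

@[simp]
theorem conv_one (f : Matrix (Fin a) (Fin b) F →₀ k) : conv f (matSingle k 1) = f := by
  simp only [conv_matSingle_right, Matrix.mul_one]
  exact Finsupp.mapDomain_id

end Conv

/-! ### Rank factorisations -/

section Frame

variable {F : Type*} [Field F] {n m r : ℕ}

/-- The `n × r` matrix of the frame of an `r`-dimensional subspace of `F^n`. -/
def frameMatrix (U : Subspaces F n r) : Matrix (Fin n) (Fin r) F :=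
  LinearMap.toMatrix' (U.1.subtype ∘ₗ (subspaceFrame U).toLinearMap)

theorem frameMatrix_mulVec (U : Subspaces F n r) (x : Fin r → F) :
    (frameMatrix U).mulVec x = subspaceFrame U x := by
  rw [frameMatrix, LinearMap.toMatrix'_mulVec]; rfl

theorem frameMatrix_mulVec_injective (U : Subspaces F n r) :
    Function.Injective (frameMatrix U).mulVec := fun x y h => by
  rw [frameMatrix_mulVec, frameMatrix_mulVec] at h
  exact (subspaceFrame U).injective (Subtype.ext h)

theorem range_frameMatrix (U : Subspaces F n r) :
    LinearMap.range (frameMatrix U).mulVecLin = U.1 := by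
  have : (frameMatrix U).mulVecLin = U.1.subtype ∘ₗ (subspaceFrame U).toLinearMap :=
    LinearMap.ext fun x => frameMatrix_mulVec U x
  rw [this, LinearMap.range_comp, LinearEquiv.range, Submodule.map_top, Submodule.range_subtype]

theorem frameMatrix_mul_left_injective (U : Subspaces F n r) :
    Function.Injective fun y : Matrix (Fin r) (Fin m) F => frameMatrix U * y := fun y z h =>
  Matrix.ext_of_mulVec_single fun i => frameMatrix_mulVec_injective U (by
    simpa only [Matrix.mulVec_mulVec] using congrArg (fun w => Matrix.mulVec w (Pi.single i 1)) h)

theorem mul_frameMatrix_transpose_injective (U : Subspaces F m r) :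
    Function.Injective fun x : Matrix (Fin n) (Fin r) F => x * (frameMatrix U).transpose :=
  fun x y h => Matrix.transpose_injective (frameMatrix_mul_left_injective U (by
    simpa [Matrix.transpose_mul] using congrArg Matrix.transpose h))

theorem rank_frameMatrix_mul (U : Subspaces F n r) (y : Matrix (Fin r) (Fin m) F) :
    (frameMatrix U * y).rank = y.rank := by
  rw [Matrix.rank, Matrix.rank, Matrix.mulVecLin_mul, LinearMap.range_comp]
  exact (Submodule.equivMapOfInjective _ (frameMatrix_mulVec_injective U) _).finrank_eq.symm

theorem rank_mul_frameMatrix_transpose (U : Subspaces F m r) (x : Matrix (Fin n) (Fin r) F) :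
    (x * (frameMatrix U).transpose).rank = x.rank := by
  rw [← Matrix.rank_transpose, Matrix.transpose_mul, Matrix.transpose_transpose,
    rank_frameMatrix_mul, Matrix.rank_transpose]

theorem range_frameMatrix_mul (U : Subspaces F n r) (y : Matrix (Fin r) (Fin m) F)
    (hy : y.rank = r) : LinearMap.range (frameMatrix U * y).mulVecLin = U.1 := by
  refine Submodule.eq_of_le_of_finrank_eq ?_ ?_
  · rw [Matrix.mulVecLin_mul]
    exact (LinearMap.range_comp_le_range _ _).trans (range_frameMatrix U).le
  · rw [← Matrix.rank, rank_frameMatrix_mul, hy, U.2]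

/-- A matrix factors through the frame of its column space. -/
theorem exists_eq_frameMatrix_mul (x : Matrix (Fin n) (Fin m) F) :
    ∃ (W : Subspaces F n x.rank) (y : Matrix (Fin x.rank) (Fin m) F),
      y.rank = x.rank ∧ x = frameMatrix W * y := by
  let W : Subspaces F n x.rank := ⟨LinearMap.range x.mulVecLin, rfl⟩
  let y : Matrix (Fin x.rank) (Fin m) F :=
    LinearMap.toMatrix' ((subspaceFrame W).symm.toLinearMap ∘ₗ x.mulVecLin.rangeRestrict)
  have h : x = frameMatrix W * y := Matrix.ext_of_mulVec_single fun i => by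
    rw [← Matrix.mulVec_mulVec, frameMatrix_mulVec, LinearMap.toMatrix'_mulVec]
    simp only [LinearMap.coe_comp, Function.comp_apply, LinearEquiv.coe_coe,
      LinearEquiv.apply_symm_apply]
    rfl
  refine ⟨W, y, ?_, h⟩
  rw [← rank_frameMatrix_mul W y, ← h]

/-- A matrix factors through the frame of its row space. -/
theorem exists_eq_mul_frameMatrix_transpose (x : Matrix (Fin n) (Fin m) F) :
    ∃ (U : Subspaces F m x.rank) (u : Matrix (Fin n) (Fin x.rank) F),
      u.rank = x.rank ∧ x = u * (frameMatrix U).transpose := by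
  suffices H : ∀ r, r = x.transpose.rank → ∃ (U : Subspaces F m r) (u : Matrix (Fin n) (Fin r) F),
      u.rank = r ∧ x = u * (frameMatrix U).transpose from H _ x.rank_transpose.symm
  rintro _ rfl
  obtain ⟨W, y, hy, h⟩ := exists_eq_frameMatrix_mul x.transpose
  refine ⟨W, y.transpose, by rw [Matrix.rank_transpose, hy], ?_⟩
  rw [← Matrix.transpose_mul, ← h, Matrix.transpose_transpose]

/-- When `u` has full column rank, `U` is recovered as the row space of the product. -/
theorem eq_of_mul_frameMatrix_transpose_eq {U U' : Subspaces F m r}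
    {u u' : Matrix (Fin n) (Fin r) F} (hu : u.rank = r)
    (h : u * (frameMatrix U).transpose = u' * (frameMatrix U').transpose) : U = U' := by
  have hu' : u'.rank = r := by
    rw [← rank_mul_frameMatrix_transpose U', ← h, rank_mul_frameMatrix_transpose, hu]
  have h' := congrArg Matrix.transpose h
  simp only [Matrix.transpose_mul, Matrix.transpose_transpose] at h'
  apply Subtype.ext
  rw [← range_frameMatrix_mul U u.transpose (by rw [Matrix.rank_transpose, hu]), h',
    range_frameMatrix_mul U' u'.transpose (by rw [Matrix.rank_transpose, hu'])]

theorem eq_of_frameMatrix_mul_eq {U U' : Subspaces F n r}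
    {u u' : Matrix (Fin r) (Fin m) F} (hu : u.rank = r)
    (h : frameMatrix U * u = frameMatrix U' * u') : U = U' := by
  refine eq_of_mul_frameMatrix_transpose_eq (u := u.transpose) (u' := u'.transpose)
    (by rw [Matrix.rank_transpose, hu]) ?_
  rw [← Matrix.transpose_mul, ← Matrix.transpose_mul, h]

theorem isUnit_iff_rank_eq (x : Matrix (Fin r) (Fin r) F) : IsUnit x ↔ x.rank = r := by
  constructor
  · intro h
    simpa using Matrix.rank_of_isUnit x h
  · intro h
    rw [← Matrix.mulVec_surjective_iff_isUnit]
    have := Submodule.eq_top_of_finrank_eq (K := F) (S := LinearMap.range x.mulVecLin)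
      (by rw [← Matrix.rank, h, Module.finrank_fin_fun])
    exact LinearMap.range_eq_top.1 this

theorem rank_GL (g : GL (Fin r) F) : (g : Matrix (Fin r) (Fin r) F).rank = r :=
  (isUnit_iff_rank_eq _).1 g.isUnit

end Frame

/-! ### The Fourier transform on matrices -/

section Fourier

variable {k : Type*} [Field k] {F : Type*} [Field F]

/-- A primitive character takes values in a cyclotomic extension of `k`; as `k` is algebraically
closed, that extension embeds back into `k`. -/
theorem exists_addChar_ne_one (k : Type*) [Field k] [IsAlgClosed k] [CharZero k] (F : Type*)
    [Field F] [Finite F] : ∃ ψ : AddChar F k, ψ ≠ 1 := by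
  have hchar : ringChar k ≠ ringChar F := by
    rw [ringChar.eq_zero]
    exact (CharP.ringChar_ne_zero_of_finite F).symm
  let χ := AddChar.FiniteField.primitiveChar F k hchar
  have : NeZero (χ.n : ℕ) := ⟨χ.n.pos.ne'⟩
  have : Algebra.IsAlgebraic k (CyclotomicField χ.n k) := by
    have := IsCyclotomicExtension.finiteDimensional {(χ.n : ℕ)} k (CyclotomicField χ.n k)
    infer_instance
  let φ : CyclotomicField χ.n k →ₐ[k] k := IsAlgClosed.lift
  refine ⟨φ.toRingHom.toMonoidHom.compAddChar χ.char, ?_⟩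
  have h := χ.prim one_ne_zero
  rw [AddChar.ne_one_iff] at h ⊢
  obtain ⟨x, hx⟩ := h
  rw [AddChar.mulShift_apply, one_mul] at hx
  exact ⟨x, fun h => hx (φ.toRingHom.injective (by simpa using h))⟩

variable (ψ : AddChar F k) {a b c : ℕ}

/-- The Fourier transform `k[Mat_{a,b}] → k^(Mat_{b,a})` given by an additive character `ψ`. -/
def matFourier : (Matrix (Fin a) (Fin b) F →₀ k) →ₗ[k] (Matrix (Fin b) (Fin a) F → k) :=
  LinearMap.pi fun y => Finsupp.linearCombination k fun x => ψ (y * x).trace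

theorem matFourier_apply (f : Matrix (Fin a) (Fin b) F →₀ k) (y : Matrix (Fin b) (Fin a) F) :
    matFourier ψ f y = f.sum fun x s => s * ψ (y * x).trace := by
  simp [matFourier, Finsupp.linearCombination_apply]

/-- This turns annihilation into a support condition: `x` kills `f` on the left as soon as the
transform of `f` vanishes at all the matrices `y * x`, because the transform is injective. -/
theorem matFourier_conv (x : Matrix (Fin a) (Fin b) F) (f : Matrix (Fin b) (Fin c) F →₀ k)
    (y : Matrix (Fin c) (Fin a) F) :
    matFourier ψ (conv (matSingle k x) f) y = matFourier ψ f (y * x) := by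
  induction f using Finsupp.induction_linear with
  | zero => simp
  | add f g hf hg => simp only [map_add, Pi.add_apply, hf, hg]
  | single z s => simp [conv_single_single, matFourier_apply, Matrix.mul_assoc]

variable {ψ} [Finite F]

omit [Finite F] in
theorem sum_addChar_trace [Fintype (Matrix (Fin b) (Fin a) F)] (hψ : ψ ≠ 1)
    {x : Matrix (Fin a) (Fin b) F} (hx : x ≠ 0) :
    ∑ y : Matrix (Fin b) (Fin a) F, ψ (y * x).trace = 0 := by
  let χ : AddChar (Matrix (Fin b) (Fin a) F) k := ψ.compAddMonoidHom
    ((Matrix.traceAddMonoidHom (Fin b) F).comp (Matrix.addMonoidHomMulRight x))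
  refine AddChar.sum_eq_zero_of_ne_one (ψ := χ) ?_
  rw [AddChar.ne_one_iff] at hψ ⊢
  obtain ⟨t, ht⟩ := hψ
  obtain ⟨i, j, hij⟩ : ∃ i j, x i j ≠ 0 := by
    by_contra! h
    exact hx (Matrix.ext h)
  -- This matrix is chosen so that its product with `x` has trace `t`, where `ψ t ≠ 1`.
  refine ⟨Matrix.single j i (t * (x i j)⁻¹), ?_⟩
  have : χ (Matrix.single j i (t * (x i j)⁻¹)) =
      ψ (Matrix.single j i (t * (x i j)⁻¹) * x).trace := rfl
  rwa [this, Matrix.trace_single_mul, smul_eq_mul, mul_assoc, inv_mul_cancel₀ hij, mul_one]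

theorem matFourier_injective [CharZero k] (hψ : ψ ≠ 1) :
    Function.Injective (matFourier ψ : (Matrix (Fin a) (Fin b) F →₀ k) → _) := by
  classical
  have := Fintype.ofFinite (Matrix (Fin b) (Fin a) F)
  rw [injective_iff_map_eq_zero]
  intro f hf
  ext x
  -- Fourier inversion; the factor, a number of matrices, is nonzero in characteristic `0`.
  have h : ∑ y : Matrix (Fin b) (Fin a) F, ψ (-(y * x).trace) * matFourier ψ f y =
      Fintype.card (Matrix (Fin b) (Fin a) F) * f x := by
    simp only [matFourier_apply, Finsupp.sum, Finset.mul_sum]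
    rw [Finset.sum_comm]
    have : ∀ z : Matrix (Fin a) (Fin b) F, ∑ y : Matrix (Fin b) (Fin a) F,
        ψ (-(y * x).trace) * (f z * ψ (y * z).trace) =
          if z = x then Fintype.card (Matrix (Fin b) (Fin a) F) * f x else 0 := by
      intro z
      have e : ∀ y : Matrix (Fin b) (Fin a) F, ψ (-(y * x).trace) * (f z * ψ (y * z).trace) =
          f z * ψ (y * (z - x)).trace := fun y => by
        rw [Matrix.mul_sub, Matrix.trace_sub, sub_eq_neg_add, AddChar.map_add_eq_mul]
        ring
      simp only [e, ← Finset.mul_sum]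
      split_ifs with hz
      · subst hz
        simp [mul_comm]
      · rw [sum_addChar_trace hψ (sub_ne_zero.2 hz), mul_zero]
    simp only [this, Finset.sum_ite_eq', Finsupp.mem_support_iff]
    split_ifs with h0
    · rfl
    · rw [not_not.1 h0, mul_zero]
  simp only [hf, Pi.zero_apply, mul_zero, Finset.sum_const_zero] at h
  have hc : (Fintype.card (Matrix (Fin b) (Fin a) F) : k) ≠ 0 :=
    Nat.cast_ne_zero.2 Fintype.card_ne_zero
  simpa [hc] using h.symm

theorem matFourier_bijective [CharZero k] (hψ : ψ ≠ 1) :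
    Function.Bijective (matFourier ψ : (Matrix (Fin a) (Fin a) F →₀ k) → _) := by
  have := Fintype.ofFinite (Matrix (Fin a) (Fin a) F)
  refine ⟨matFourier_injective hψ,
    (LinearMap.injective_iff_surjective_of_finrank_eq_finrank ?_).1 (matFourier_injective hψ)⟩
  simp

/-- An element annihilated by all `b × a` matrices vanishes. -/
theorem eq_zero_of_conv_eq_zero [IsAlgClosed k] [CharZero k] (f : Matrix (Fin a) (Fin b) F →₀ k)
    (h : ∀ y : Matrix (Fin b) (Fin a) F, conv (matSingle k y) f = 0) : f = 0 := by
  obtain ⟨ψ, hψ⟩ := exists_addChar_ne_one k F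
  refine matFourier_injective hψ ((funext fun y => ?_).trans (map_zero _).symm)
  -- The transform of `f` at `y` is that of `y f` at the identity matrix.
  have := matFourier_conv ψ y f 1
  rw [h, map_zero, Matrix.one_mul] at this
  exact this.symm

end Fourier

/-! ### Elements annihilated by the matrices of smaller rank -/

section Primitive

variable {k : Type*} [Field k] {F : Type*} [Field F] {n m r : ℕ}

/-- An element `ε` of `k[Mat_r]` that is congruent to `1` modulo the singular matrices and is
annihilated from the left by all matrices of rank less than `r`. -/
structure IsTopElement (ε : Matrix (Fin r) (Fin r) F →₀ k) : Prop where
  apply_one : ε 1 = 1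
  apply_of_rank_eq : ∀ x : Matrix (Fin r) (Fin r) F, x.rank = r → x ≠ 1 → ε x = 0
  conv_eq_zero : ∀ (n : ℕ) (x : Matrix (Fin n) (Fin r) F), x.rank < r → conv (matSingle k x) ε = 0

/-- Convolution with a top element only sees the matrices of full rank. -/
theorem IsTopElement.conv_eq_of {ε : Matrix (Fin r) (Fin r) F →₀ k} (hε : IsTopElement ε)
    (g : Matrix (Fin n) (Fin r) F →₀ k) (hg : ∀ x, x.rank = r → g x = 0) : conv g ε = 0 := by
  rw [conv_eq_sum]
  refine Finset.sum_eq_zero fun x _ => ?_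
  rcases (Matrix.rank_le_width x).lt_or_eq with h | h
  · simp only [hε.conv_eq_zero n x h, smul_zero]
  · simp only [hg x h, zero_smul]

/-- `ε - 1` is supported on singular matrices, so `(ε - 1) ε = 0`. -/
theorem IsTopElement.conv_self {ε : Matrix (Fin r) (Fin r) F →₀ k} (hε : IsTopElement ε) :
    conv ε ε = ε := by
  have := hε.conv_eq_of (ε - matSingle k 1) fun x hx => ?_
  · rwa [map_sub, LinearMap.sub_apply, one_conv, sub_eq_zero] at this
  · by_cases h : x = 1
    · subst h; simp [hε.apply_one]
    · simp [hε.apply_of_rank_eq x hx h, Ne.symm h]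

/-- An element `g ε` that vanishes on the matrices of full rank is zero. -/
theorem IsTopElement.conv_eq_zero_of {ε : Matrix (Fin r) (Fin r) F →₀ k} (hε : IsTopElement ε)
    (g : Matrix (Fin n) (Fin r) F →₀ k) (hg : ∀ x, x.rank = r → conv g ε x = 0) :
    conv g ε = 0 := by
  have := hε.conv_eq_of (conv g ε) hg
  rwa [conv_assoc, hε.conv_self] at this

/-- A subspace containing all `u ε_s A_Uᵀ` with `u` of full rank `s < N` contains all matrices of
rank less than `N`. -/
theorem matSingle_mem_of_rank_lt {N : ℕ} (ε : ∀ s, Matrix (Fin s) (Fin s) F →₀ k)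
    (hε : ∀ s < N, IsTopElement (ε s)) (X : Submodule k (Matrix (Fin n) (Fin m) F →₀ k))
    (hX : ∀ s < N, ∀ (U : Subspaces F m s) (u : Matrix (Fin n) (Fin s) F), u.rank = s →
      conv (conv (matSingle k u) (ε s)) (matSingle k (frameMatrix U).transpose) ∈ X)
    (x : Matrix (Fin n) (Fin m) F) (hx : x.rank < N) : matSingle k x ∈ X := by
  induction hs : x.rank using Nat.strong_induction_on generalizing x with
  | _ s ih =>
  obtain ⟨U, u, hu, hxu⟩ := exists_eq_mul_frameMatrix_transpose x
  have htop := hε _ hx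
  have h1 := hX _ hx U u hu
  -- With `ε = 1 + (ε - 1)`, the given element of `X` becomes `x` plus a combination of matrices of
  -- smaller rank, which lie in `X` by induction.
  rw [← add_sub_cancel (matSingle k 1) (ε x.rank), map_add, map_add, LinearMap.add_apply,
    conv_one, conv_single_single, ← hxu, mul_one] at h1
  refine (Submodule.add_mem_iff_left _ ?_).1 h1
  rw [conv_assoc, conv_matSingle_right, conv_matSingle_left, ← Finsupp.mapDomain_comp]
  rw [Finsupp.mapDomain, Finsupp.sum]
  refine Submodule.sum_mem _ fun z hz => ?_
  rw [← Finsupp.smul_single_one]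
  refine Submodule.smul_mem _ _ ?_
  have hzr : z.rank < x.rank := by
    refine lt_of_le_of_ne z.rank_le_width fun h => ?_
    rw [Finsupp.mem_support_iff] at hz
    apply hz
    by_cases hz1 : z = 1
    · subst hz1; simp [htop.apply_one]
    · simp [htop.apply_of_rank_eq z h hz1, Ne.symm hz1]
  have hlt : (u * (z * (frameMatrix U).transpose)).rank < x.rank :=
    (Matrix.rank_mul_le_right _ _).trans_lt (by rwa [rank_mul_frameMatrix_transpose])
  exact ih _ (hs ▸ hlt) _ (hlt.trans hx) rfl

variable [Finite F]

/-- The submodules `k[Mat_{n,s}] ε_s A_Uᵀ` of `k[Mat_{n,m}]` are independent. -/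
theorem conv_eq_zero_of_sum_eq_zero {N : ℕ} (ε : ∀ s, Matrix (Fin s) (Fin s) F →₀ k)
    (hε : ∀ s < N, IsTopElement (ε s))
    (g : ∀ s : Fin N, Subspaces F m s → (Matrix (Fin n) (Fin s) F →₀ k))
    (h : ∑ s : Fin N, ∑ U : Subspaces F m s,
      conv (conv (g s U) (ε s)) (matSingle k (frameMatrix U).transpose) = 0)
    (s : Fin N) : ∀ U : Subspaces F m s, conv (g s U) (ε s) = 0 := by
  -- Descending induction. At a matrix `z A_Uᵀ` with `z` of rank `s`, the terms with larger `s'`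
  -- vanish by induction, those with smaller `s'` have too small a rank, and those with `U' ≠ U`
  -- have another row space.
  induction s using WellFoundedGT.induction with
  | ind s ih =>
  intro U
  refine (hε s s.2).conv_eq_zero_of _ fun z hz => ?_
  have h1 := DFunLike.congr_fun h (z * (frameMatrix U).transpose)
  rw [Finsupp.finsetSum_apply, Finset.sum_eq_single s, Finsupp.finsetSum_apply,
    Finset.sum_eq_single U, conv_matSingle_right,
    Finsupp.mapDomain_apply (mul_frameMatrix_transpose_injective U)] at h1
  · exact h1
  · intro U' _ hU'
    rw [conv_matSingle_right, Finsupp.mapDomain_of_notMem_range]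
    rintro ⟨z', hz'⟩
    exact hU' (eq_of_mul_frameMatrix_transpose_eq hz hz'.symm).symm
  · simp
  · intro s' _ hs'
    rw [Finsupp.finsetSum_apply]
    refine Finset.sum_eq_zero fun U' _ => ?_
    rcases hs'.lt_or_gt with hlt | hgt
    · rw [conv_matSingle_right, Finsupp.mapDomain_of_notMem_range]
      rintro ⟨z', hz'⟩
      have h2 := congrArg Matrix.rank hz'
      simp only [rank_mul_frameMatrix_transpose, hz] at h2
      have := z'.rank_le_width
      have : (s' : ℕ) < s := hlt
      omega
    · rw [ih s' hgt]; simp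
  · simp

variable [IsAlgClosed k] [CharZero k]

/-- An element supported on the singular matrices and annihilated by the singular matrices
vanishes, provided top elements exist in smaller sizes. -/
theorem eq_zero_of_singular (ε : ∀ s, Matrix (Fin s) (Fin s) F →₀ k)
    (hε : ∀ s < r, IsTopElement (ε s)) (f : Matrix (Fin r) (Fin r) F →₀ k)
    (hf : ∀ x, x.rank = r → f x = 0)
    (h : ∀ (n : ℕ) (x : Matrix (Fin n) (Fin r) F), x.rank < r → conv (matSingle k x) f = 0) :
    f = 0 := by
  let S : (∀ s : Fin r, Subspaces F r s → (Matrix (Fin r) (Fin s) F →₀ k)) →ₗ[k]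
      (Matrix (Fin r) (Fin r) F →₀ k) :=
    ∑ s : Fin r, ∑ U : Subspaces F r s,
      conv.flip (matSingle k (frameMatrix U).transpose) ∘ₗ conv.flip (ε s) ∘ₗ
        LinearMap.proj U ∘ₗ LinearMap.proj s
  have hS : ∀ g, S g = ∑ s : Fin r, ∑ U : Subspaces F r s,
      conv (conv (g s U) (ε s)) (matSingle k (frameMatrix U).transpose) := fun g => by
    simp [S, LinearMap.sum_apply]
  -- By triangularity in the rank, `f` is a sum of terms `g ε_s A_Uᵀ` with `s < r`.
  have hmem : f ∈ LinearMap.range S := by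
    rw [← Finsupp.sum_single f]
    refine Submodule.sum_mem _ fun x hx => ?_
    have hxr : x.rank < r := lt_of_le_of_ne x.rank_le_width fun h =>
      Finsupp.mem_support_iff.1 hx (hf x h)
    rw [← Finsupp.smul_single_one]
    refine Submodule.smul_mem _ _ (matSingle_mem_of_rank_lt ε hε _ (fun s hs U u _ => ?_) x hxr)
    classical
    refine ⟨Pi.single ⟨s, hs⟩ (Pi.single U (matSingle k u)), ?_⟩
    rw [hS, Finset.sum_eq_single ⟨s, hs⟩, Finset.sum_eq_single U]
    · simp
    · intro U' _ hU'; simp [hU']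
    · simp
    · intro s' _ hs'; simp [hs']
    · simp
  obtain ⟨g, rfl⟩ := hmem
  rw [hS]
  refine Finset.sum_eq_zero fun s _ => Finset.sum_eq_zero fun U _ => ?_
  suffices conv (g s U) (ε s) = 0 by simp [this]
  -- A matrix `y` with `s < r` rows has rank below `r`, hence kills `f`; by independence it kills
  -- each `g ε_s` separately.
  refine eq_zero_of_conv_eq_zero _ fun y => ?_
  rw [← conv_assoc]
  refine conv_eq_zero_of_sum_eq_zero ε hε (fun s U => conv (matSingle k y) (g s U)) ?_ s U
  have hy := h s y (y.rank_le_height.trans_lt s.2)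
  rw [hS] at hy
  simpa only [map_sum, conv_assoc] using hy

/-- Top elements exist. -/
theorem exists_isTopElement (k : Type*) [Field k] [IsAlgClosed k] [CharZero k] (F : Type*) [Field F]
    [Finite F] (r : ℕ) : ∃ ε : Matrix (Fin r) (Fin r) F →₀ k, IsTopElement ε := by
  induction r using Nat.strong_induction_on with
  | _ r ih =>
  classical
  obtain ⟨ε, hε⟩ : ∃ ε : ∀ s, Matrix (Fin s) (Fin s) F →₀ k, ∀ s < r, IsTopElement (ε s) := by
    choose ε hε using ih
    exact ⟨fun s => if h : s < r then ε s h else 0, fun s h => by simpa only [dif_pos h] using hε s h⟩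
  obtain ⟨ψ, hψ⟩ := exists_addChar_ne_one k F
  let T : (Matrix (Fin r) (Fin r) F →₀ k) ≃ₗ[k] (Matrix (Fin r) (Fin r) F → k) :=
    LinearEquiv.ofBijective (matFourier ψ) (matFourier_bijective hψ)
  let H := {x : Matrix (Fin r) (Fin r) F // x.rank = r}
  let E : (H → k) →ₗ[k] (Matrix (Fin r) (Fin r) F → k) :=
    LinearMap.pi fun x => if hx : x.rank = r then LinearMap.proj (⟨x, hx⟩ : H) else 0
  -- Extend by zero from the invertible matrices, invert the Fourier transform, and keep the
  -- coefficients at the invertible matrices.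
  let R : (H → k) →ₗ[k] (H → k) :=
    LinearMap.pi fun x => Finsupp.lapply x.1 ∘ₗ T.symm.toLinearMap ∘ₗ E
  have hkill : ∀ h (n : ℕ) (x : Matrix (Fin n) (Fin r) F), x.rank < r →
      conv (matSingle k x) (T.symm (E h)) = 0 := fun h n x hx => by
    refine matFourier_injective hψ ((funext fun y => ?_).trans (map_zero _).symm)
    rw [matFourier_conv]
    have hlt : (y * x).rank ≠ r := ((Matrix.rank_mul_le_right y x).trans_lt hx).ne
    have : matFourier ψ (T.symm (E h)) = E h := T.apply_symm_apply _
    rw [this]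
    simp [E, hlt]
  have hinj : Function.Injective R := by
    rw [injective_iff_map_eq_zero]
    intro h hh
    have h0 : T.symm (E h) = 0 := eq_zero_of_singular ε hε _
      (fun x hx => congrFun hh ⟨x, hx⟩) (hkill h)
    rw [LinearEquiv.map_eq_zero_iff] at h0
    ext x
    simpa [E, x.2] using congrFun h0 x.1
  have h1 : (1 : Matrix (Fin r) (Fin r) F).rank = r := by simp
  obtain ⟨h, hh⟩ := (LinearMap.injective_iff_surjective.1 hinj) (Pi.single ⟨1, h1⟩ 1)
  refine ⟨T.symm (E h), ?_, fun x hx hx1 => ?_, hkill h⟩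
  · simpa [R] using congrFun hh ⟨1, h1⟩
  · have := congrFun hh ⟨x, hx⟩
    rwa [Pi.single_eq_of_ne (fun h => hx1 (congrArg Subtype.val h))] at this

end Primitive

/-! ### The regular representation of a finite group -/

section Regular

universe u v

open Representation

variable {k : Type u} [Field k] {G : Type v} [Group G]

instance IrrRep.isSimpleModule (π : IrrRep k G) :
    IsSimpleModule (MonoidAlgebra k G) π.ρ.asModule :=
  (irreducible_iff_isSimpleModule_asModule _).1 π.irreducible

instance [Finite G] : Module.Finite k (MonoidAlgebra k G) :=
  Module.Finite.equiv (MonoidAlgebra.coeffLinearEquiv k).symm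

instance IrrRep.finite_asModule [Finite G] (π : IrrRep k G) : Module.Finite k π.ρ.asModule :=
  Module.Finite.trans (MonoidAlgebra k G) _

instance IrrRep.finite [Finite G] (π : IrrRep k G) : Module.Finite k π.V :=
  Module.Finite.equiv π.ρ.asModuleEquiv

theorem IrrRep.equiv_of_linearMap_ne_zero {π σ : IrrRep k G}
    (f : π.ρ.asModule →ₗ[MonoidAlgebra k G] σ.ρ.asModule) (hf : f ≠ 0) : π ≈ σ :=
  ⟨((IntertwiningMap.equivLinearMapAsModule π.ρ σ.ρ).symm f).ofBijective
    (f.bijective_or_eq_zero.resolve_right hf)⟩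

variable [Finite G] [IsAlgClosed k]

/-- Pairwise non-isomorphic irreducible representations are jointly dense. -/
theorem IrrRep.exists_asAlgebraHom_eq [CharZero k] {ι : Type*} [Finite ι] (π : ι → IrrRep k G)
    (hπ : ∀ i j, π i ≈ π j → i = j) (g : ∀ i, Module.End k (π i).V) :
    ∃ a : MonoidAlgebra k G, ∀ i, asAlgebraHom (π i).ρ a = g i := by
  classical
  have := Fintype.ofFinite ι
  have : NeZero (Nat.card G : k) := ⟨Nat.cast_ne_zero.2 Nat.card_pos.ne'⟩
  let g' : ∀ i, (π i).ρ.asModule →ₗ[k] (π i).ρ.asModule := g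
  -- By Schur's lemma the blocks of `φ` are scalars on the diagonal and zero off it, so `φ` commutes
  -- with every family `g`. The density theorem then realises `g` by an element of the group
  -- algebra.
  have hcomm : ∀ (φ : Module.End (MonoidAlgebra k G) (∀ i, (π i).ρ.asModule))
      (m : ∀ i, (π i).ρ.asModule) (j : ι), φ (fun i => g' i (m i)) j = g' j (φ m j) := by
    intro φ m j
    have key : ∀ i (v : (π i).ρ.asModule),
        φ (Pi.single i (g' i v)) j = g' j (φ (Pi.single i v) j) := by
      intro i v
      let ψ : (π i).ρ.asModule →ₗ[MonoidAlgebra k G] (π j).ρ.asModule :=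
        LinearMap.proj j ∘ₗ φ ∘ₗ LinearMap.single (MonoidAlgebra k G) (fun i => (π i).ρ.asModule) i
      change ψ (g' i v) = g' j (ψ v)
      by_cases hij : i = j
      · subst hij
        obtain ⟨c, hc⟩ := (IsSimpleModule.algebraMap_end_bijective_of_isAlgClosed k).2 ψ
        rw [← hc, Module.algebraMap_end_apply, Module.algebraMap_end_apply, map_smul]
      · have : ψ = 0 := by
          by_contra h
          exact hij (hπ i j (IrrRep.equiv_of_linearMap_ne_zero ψ h))
        rw [this, LinearMap.zero_apply, LinearMap.zero_apply, map_zero]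
    conv_lhs => rw [← Finset.univ_sum_single fun i => g' i (m i)]
    conv_rhs => rw [← Finset.univ_sum_single m]
    simp only [map_sum, Finset.sum_apply, key]
  let f : Module.End (Module.End (MonoidAlgebra k G) (∀ i, (π i).ρ.asModule))
      (∀ i, (π i).ρ.asModule) :=
    { toFun := fun m i => g' i (m i)
      map_add' := fun x y => funext fun i => map_add (g' i) (x i) (y i)
      map_smul' := fun φ m => funext fun i => (hcomm φ m i).symm }
  have : Module.Finite (Module.End (MonoidAlgebra k G) (∀ i, (π i).ρ.asModule))
      (∀ i, (π i).ρ.asModule) := Module.Finite.of_restrictScalars_finite k _ _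
  obtain ⟨a, ha⟩ := Module.Finite.toModuleEnd_moduleEnd_surjective (R := MonoidAlgebra k G) f
  refine ⟨a, fun i => LinearMap.ext fun (v : (π i).ρ.asModule) => ?_⟩
  have h1 := congrFun (LinearMap.congr_fun ha (Pi.single i v)) i
  have h2 : a • ((Pi.single i v : ∀ i, (π i).ρ.asModule) i) =
    g' i ((Pi.single i v : ∀ i, (π i).ρ.asModule) i) := h1
  rw [Pi.single_eq_same] at h2
  exact h2

omit [IsAlgClosed k] in
/-- An element of the group algebra that acts by zero on every irreducible representation
vanishes. -/
theorem IrrRep.eq_zero_of_asAlgebraHom_eq_zero [CharZero k] (a : MonoidAlgebra k G)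
    (ha : ∀ π : IrrRep k G, asAlgebraHom π.ρ a = 0) : a = 0 := by
  let A := MonoidAlgebra k G
  have : NeZero (Nat.card G : k) := ⟨Nat.cast_ne_zero.2 Nat.card_pos.ne'⟩
  have key : ∀ N : Submodule A A, IsSimpleModule A N → ∀ x ∈ N, a • x = 0 := by
    intro N hN x hx
    have : Module.Finite k N := Module.Finite.trans A N
    -- Coordinates move the simple left ideal `N` into the universe of `k`, as `IrrRep` requires.
    let e : N ≃ₗ[k] (Fin (Module.finrank k N) → k) := LinearEquiv.ofFinrankEq _ _ (by simp)
    let φ : A →ₐ[k] Module.End k (Fin (Module.finrank k N) → k) :=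
      (e.conjAlgEquiv k).toAlgHom.comp (Algebra.lsmul k k N)
    let ρ : Representation k G (Fin (Module.finrank k N) → k) :=
      (φ : A →* _).comp (MonoidAlgebra.of k G)
    have hρ : asAlgebraHom ρ = φ := by
      exact (MonoidAlgebra.lift k _ G).apply_symm_apply φ
    let E : ρ.asModule ≃ₗ[A] N :=
      { toFun := fun v => e.symm (ρ.asModuleEquiv v)
        invFun := fun v => ρ.asModuleEquiv.symm (e v)
        map_add' := fun v w => by simp
        map_smul' := fun b v => by
          rw [asModuleEquiv_map_smul, hρ]
          simp [φ, LinearEquiv.conjAlgEquiv_apply]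
        left_inv := fun v => by simp
        right_inv := fun v => by simp }
    have hs : IsSimpleModule A ρ.asModule := IsSimpleModule.congr E
    have h0 := ha ⟨_, ρ, (irreducible_iff_isSimpleModule_asModule ρ).2 hs⟩
    have h1 : a • E.symm ⟨x, hx⟩ = 0 := by
      apply ρ.asModuleEquiv.injective
      rw [asModuleEquiv_map_smul]
      simp only at h0
      rw [h0]; simp
    rw [← map_smul, LinearEquiv.map_eq_zero_iff] at h1
    exact congrArg Subtype.val h1
  let Z : Submodule A A := sSup {N | IsSimpleModule A N}
  have hZ : (1 : A) ∈ Z := by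
    -- Maschke's theorem: the simple left ideals span the group algebra, so an element killing all
    -- of them kills `1`.
    have : Z = ⊤ := IsSemisimpleModule.sSup_simples_eq_top A A
    rw [this]; trivial
  suffices ∀ x ∈ Z, a * x = 0 by simpa using this 1 hZ
  intro x hx
  have hx : x ∈ ⨆ N : {N : Submodule A A | IsSimpleModule A N}, N.1 := by rwa [← sSup_eq_iSup']
  refine Submodule.iSup_induction _ (motive := fun x => a * x = 0) hx
    (fun N x hx => key N N.2 x hx) (mul_zero a) fun x y hx hy => ?_
  rw [mul_add, hx, hy, add_zero]

omit [Finite G] [IsAlgClosed k] in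
theorem IrrClass.eq_of_rep_equiv {c d : IrrClass k G} (h : c.rep ≈ d.rep) : c = d := by
  rw [← Quotient.out_eq c, ← Quotient.out_eq d]
  exact Quotient.sound h

omit [Finite G] [IsAlgClosed k] in
theorem IrrClass.asAlgebraHom_eq_zero (a : MonoidAlgebra k G)
    (h : ∀ c : IrrClass k G, asAlgebraHom c.rep.ρ a = 0) (π : IrrRep k G) :
    asAlgebraHom π.ρ a = 0 := by
  obtain ⟨c, ⟨e⟩⟩ : ∃ c : IrrClass k G, c.rep ≈ π := ⟨Quotient.mk _ π, Quotient.mk_out π⟩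
  let E := IntertwiningMap.equivLinearMapAsModule _ _ e.toIntertwiningMap
  refine LinearMap.ext fun v => ?_
  obtain ⟨w, rfl⟩ := e.toLinearEquiv.surjective v
  have h1 : asAlgebraHom π.ρ a (e.toLinearEquiv w) = e.toLinearEquiv (asAlgebraHom _ a w) :=
    (E.map_smul a w).symm
  rw [h1, h, LinearMap.zero_apply, map_zero, LinearMap.zero_apply]

variable (k G) [CharZero k]

instance IrrClass.finite : Finite (IrrClass k G) := by
  classical
  -- By density `k[G]` surjects onto the product of the endomorphism algebras over `S`, each of
  -- dimension at least one.
  have bound : ∀ S : Finset (IrrClass k G), S.card ≤ Module.finrank k (MonoidAlgebra k G) := by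
    intro S
    let Φ : MonoidAlgebra k G →ₗ[k] (∀ c : S, Module.End k c.1.rep.V) :=
      LinearMap.pi fun c => (asAlgebraHom c.1.rep.ρ).toLinearMap
    have hΦ : Function.Surjective Φ := fun g => by
      obtain ⟨a, ha⟩ := IrrRep.exists_asAlgebraHom_eq (fun c : S => c.1.rep)
        (fun i j h => Subtype.ext (IrrClass.eq_of_rep_equiv h)) g
      exact ⟨a, funext ha⟩
    refine le_trans ?_ (LinearMap.finrank_le_finrank_of_surjective hΦ)
    rw [Module.finrank_pi_fintype, ← Fintype.card_coe, ← Finset.card_univ, Finset.card_eq_sum_ones]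
    refine Finset.sum_le_sum fun c _ => ?_
    have : Nontrivial c.1.rep.V := IsSimpleModule.nontrivial (MonoidAlgebra k G) c.1.rep.ρ.asModule
    exact Module.finrank_pos
  by_contra h
  rw [not_finite_iff_infinite] at h
  obtain ⟨S, hS⟩ := Infinite.exists_subset_card_eq (IrrClass k G)
    (Module.finrank k (MonoidAlgebra k G) + 1)
  have := bound S
  omega

/-- The group algebra is the product of the endomorphism algebras of the irreducible
representations. -/
def groupAlgebraEquiv : MonoidAlgebra k G ≃ₗ[k] ∀ c : IrrClass k G, Module.End k c.rep.V :=
  LinearEquiv.ofBijective (LinearMap.pi fun c => (asAlgebraHom c.rep.ρ).toLinearMap) <| by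
    constructor
    · rw [injective_iff_map_eq_zero]
      exact fun a ha => IrrRep.eq_zero_of_asAlgebraHom_eq_zero a
        (IrrClass.asAlgebraHom_eq_zero a (congrFun ha))
    · intro g
      obtain ⟨a, ha⟩ := IrrRep.exists_asAlgebraHom_eq (fun c : IrrClass k G => c.rep)
        (fun i j h => IrrClass.eq_of_rep_equiv h) g
      exact ⟨a, funext ha⟩

variable {k G}

theorem groupAlgebraEquiv_apply (a : MonoidAlgebra k G) (c : IrrClass k G) :
    groupAlgebraEquiv k G a c = asAlgebraHom c.rep.ρ a := rfl

variable (k G) in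
theorem sum_finrank_sq [Fintype (IrrClass k G)] :
    ∑ c : IrrClass k G, Module.finrank k c.rep.V * Module.finrank k c.rep.V = Nat.card G := by
  have := Fintype.ofFinite G
  have h := (groupAlgebraEquiv k G).finrank_eq
  rw [(MonoidAlgebra.coeffLinearEquiv k).finrank_eq, Module.finrank_finsupp_self,
    Module.finrank_pi_fintype] at h
  simp only [Module.finrank_linearMap] at h
  rw [Nat.card_eq_fintype_card, h]

open Classical in
/-- The embeddings of an irreducible representation into the group algebra, indexed by a basis. -/
def regularEmbedding (c : IrrClass k G) (l : Fin (Module.finrank k c.rep.V)) :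
    c.rep.V →ₗ[k] MonoidAlgebra k G :=
  (groupAlgebraEquiv k G).symm.toLinearMap ∘ₗ
    LinearMap.single k (fun c : IrrClass k G => Module.End k c.rep.V) c ∘ₗ
      LinearMap.smulRightₗ ((Module.finBasis k c.rep.V).coord l)

theorem asAlgebraHom_regularEmbedding_self (c : IrrClass k G)
    (l : Fin (Module.finrank k c.rep.V)) (v w : c.rep.V) :
    asAlgebraHom c.rep.ρ (regularEmbedding c l v) w = (Module.finBasis k c.rep.V).coord l w • v := by
  rw [← groupAlgebraEquiv_apply]
  simp [regularEmbedding]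

theorem asAlgebraHom_regularEmbedding_of_ne {c d : IrrClass k G} (h : d ≠ c)
    (l : Fin (Module.finrank k c.rep.V)) (v : c.rep.V) :
    asAlgebraHom d.rep.ρ (regularEmbedding c l v) = 0 := by
  rw [← groupAlgebraEquiv_apply]
  simp [regularEmbedding, h]

theorem regularEmbedding_apply (c : IrrClass k G) (l : Fin (Module.finrank k c.rep.V)) (g : G)
    (v : c.rep.V) : regularEmbedding c l (c.rep.ρ g v) =
      MonoidAlgebra.single g 1 * regularEmbedding c l v := by
  apply (groupAlgebraEquiv k G).injective
  refine funext fun d => LinearMap.ext fun w => ?_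
  rw [groupAlgebraEquiv_apply, groupAlgebraEquiv_apply, map_mul, asAlgebraHom_single_one,
    Module.End.mul_apply]
  by_cases h : d = c
  · subst h
    rw [asAlgebraHom_regularEmbedding_self, asAlgebraHom_regularEmbedding_self, map_smul]
  · rw [asAlgebraHom_regularEmbedding_of_ne h, asAlgebraHom_regularEmbedding_of_ne h,
      LinearMap.zero_apply, map_zero]

theorem exists_eq_sum_regularEmbedding [Fintype (IrrClass k G)] (a : MonoidAlgebra k G) :
    ∃ v : ∀ c : IrrClass k G, Fin (Module.finrank k c.rep.V) → c.rep.V,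
      a = ∑ c, ∑ l, regularEmbedding c l (v c l) := by
  -- These are the columns of the matrix by which `a` acts on each irreducible representation.
  refine ⟨fun c l => asAlgebraHom c.rep.ρ a (Module.finBasis k c.rep.V l), ?_⟩
  apply (groupAlgebraEquiv k G).injective
  refine funext fun d => LinearMap.ext fun w => ?_
  rw [groupAlgebraEquiv_apply, groupAlgebraEquiv_apply, map_sum, Finset.sum_eq_single d, map_sum,
    LinearMap.sum_apply]
  · simp only [asAlgebraHom_regularEmbedding_self, ← map_smul, ← map_sum]
    congr 1
    exact ((Module.finBasis k d.rep.V).sum_repr w).symm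
  · intro c _ hc
    simp only [map_sum, asAlgebraHom_regularEmbedding_of_ne hc.symm, Finset.sum_const_zero]
  · simp

end Regular

/-! ### Embeddings of `L_n(π)` into `k[Mat_{n,m}]` -/

section Embedding

variable {k : Type*} [Field k] {F : Type*} [Field F] {n m r : ℕ}

variable (k F r) in
/-- The linear map `k[GL_r] → k[Mat_r]`. -/
def ofGroupAlgebra : MonoidAlgebra k (GL (Fin r) F) →ₗ[k] (Matrix (Fin r) (Fin r) F →₀ k) :=
  Finsupp.lmapDomain k k (fun g : GL (Fin r) F => (g : Matrix (Fin r) (Fin r) F)) ∘ₗ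
    (MonoidAlgebra.coeffLinearEquiv k).toLinearMap

theorem ofGroupAlgebra_single (g : GL (Fin r) F) (s : k) :
    ofGroupAlgebra k F r (MonoidAlgebra.single g s) = Finsupp.single (g : Matrix (Fin r) (Fin r) F) s := by
  simp [ofGroupAlgebra]

theorem ofGroupAlgebra_single_mul (g : GL (Fin r) F) (y : MonoidAlgebra k (GL (Fin r) F)) :
    ofGroupAlgebra k F r (MonoidAlgebra.single g 1 * y) =
      conv (matSingle k (g : Matrix (Fin r) (Fin r) F)) (ofGroupAlgebra k F r y) := by
  induction y using MonoidAlgebra.induction_linear with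
  | zero => simp
  | add x y hx hy => rw [mul_add, map_add, map_add, map_add, hx, hy]
  | single h s =>
    rw [MonoidAlgebra.single_mul_single, ofGroupAlgebra_single, ofGroupAlgebra_single,
      conv_single_single, Units.val_mul]

variable [Finite F]

/-- The map `L_n(π) → k[Mat_{n,m}]`, `w ⊗ u_W ↦ A_W j(w) ε A_Uᵀ`, where `j : π → k[GL_r]`. -/
def LEmbedding (π : IrrRep k (GL (Fin r) F)) (j : π.V →ₗ[k] MonoidAlgebra k (GL (Fin r) F))
    (ε : Matrix (Fin r) (Fin r) F →₀ k) (U : Subspaces F m r) :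
    LSpace n π →ₗ[k] (Matrix (Fin n) (Fin m) F →₀ k) :=
  conv.flip (matSingle k (frameMatrix U).transpose) ∘ₗ conv.flip ε ∘ₗ
    TensorProduct.lift (LinearMap.lcomp k (Matrix (Fin n) (Fin r) F →₀ k)
      (Finsupp.lmapDomain k k (frameMatrix : Subspaces F n r → _)) ∘ₗ conv.flip ∘ₗ
        ofGroupAlgebra k F r ∘ₗ j)

omit [Finite F] in
theorem LEmbedding_tmul_single (π : IrrRep k (GL (Fin r) F))
    (j : π.V →ₗ[k] MonoidAlgebra k (GL (Fin r) F)) (ε : Matrix (Fin r) (Fin r) F →₀ k)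
    (U : Subspaces F m r) (v : π.V) (W : Subspaces F n r) (s : k) :
    LEmbedding π j ε U (v ⊗ₜ Finsupp.single W s) =
      conv (conv (conv (Finsupp.single (frameMatrix W) s) (ofGroupAlgebra k F r (j v))) ε)
        (matSingle k (frameMatrix U).transpose) := by
  simp [LEmbedding]

omit [Finite F] in
theorem frameMatrix_mul_transition (a : Matrix (Fin n) (Fin n) F) (U W : Subspaces F n r)
    (h : subspaceImage a U.1 = W.1) :
    frameMatrix W * (transition a U W h : Matrix (Fin r) (Fin r) F) = a * frameMatrix U :=
  Matrix.ext_of_mulVec_single fun i => by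
    rw [← Matrix.mulVec_mulVec, ← Matrix.mulVec_mulVec, frameMatrix_mulVec, frameMatrix_mulVec,
      subspaceFrame_transition]

omit [Finite F] in
theorem rank_mul_frameMatrix (a : Matrix (Fin n) (Fin n) F) (U : Subspaces F n r) :
    (a * frameMatrix U).rank = Module.finrank F (subspaceImage a U.1) := by
  rw [Matrix.rank, Matrix.mulVecLin_mul, LinearMap.range_comp, range_frameMatrix]

/-- If `a` is injective on `W`, then `a A_W` is `A_{a(W)}` times the transition matrix, which the
equivariance of `j` absorbs. Otherwise every matrix in `a A_W j(w)` has rank below `r`, and `ε`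
kills it, just as `a` kills `w ⊗ u_W`. -/
theorem LEmbedding_LAction (π : IrrRep k (GL (Fin r) F))
    (j : π.V →ₗ[k] MonoidAlgebra k (GL (Fin r) F))
    (hj : ∀ g v, j (π.ρ g v) = MonoidAlgebra.single g 1 * j v)
    {ε : Matrix (Fin r) (Fin r) F →₀ k} (hε : IsTopElement ε)
    (U : Subspaces F m r) (a : Matrix (Fin n) (Fin n) F) (x : LSpace n π) :
    LEmbedding π j ε U (LAction n π a x) = conv (matSingle k a) (LEmbedding π j ε U x) := by
  suffices LEmbedding π j ε U ∘ₗ LAction n π a = conv (matSingle k a) ∘ₗ LEmbedding π j ε U from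
    LinearMap.congr_fun this x
  refine TensorProduct.ext' fun v x => ?_
  simp only [LinearMap.comp_apply]
  induction x using Finsupp.induction_linear with
  | zero => simp
  | add x y hx hy => rw [TensorProduct.tmul_add, map_add, map_add, map_add, map_add, hx, hy]
  | single W s =>
    rw [LEmbedding_tmul_single, ← conv_assoc, ← conv_assoc, ← conv_assoc, conv_single_single,
      one_mul]
    by_cases h : Module.finrank F (subspaceImage a W.1) = r
    · rw [LAction_single π a v W ⟨_, h⟩ rfl, LEmbedding_tmul_single, hj,
        ofGroupAlgebra_single_mul, ← conv_assoc, conv_single_single, mul_one,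
        frameMatrix_mul_transition]
    · rw [LAction_single_of_ne π a v W h, map_zero]
      rw [hε.conv_eq_of (conv (Finsupp.single (a * frameMatrix W) s) _), map_zero,
        LinearMap.zero_apply]
      intro x hx
      rw [← mul_one s, ← smul_eq_mul, ← Finsupp.smul_single, map_smul, LinearMap.smul_apply,
        conv_matSingle_left, Finsupp.smul_apply, Finsupp.mapDomain_of_notMem_range, smul_zero]
      rintro ⟨y, rfl⟩
      apply h
      rw [← rank_mul_frameMatrix]
      exact le_antisymm (Matrix.rank_le_width _) (hx.symm.le.trans (Matrix.rank_mul_le_left _ _))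

end Embedding

/-! ### Tensor powers as linearised matrix spaces -/

section TensorPower

variable (k : Type*) [Field k] (F : Type*) [Field F] (n m : ℕ)

/-- The basis of `V^{⊗m}` indexed by matrices, whose columns give the tensor factors. -/
def tensorPowerBasis :
    Module.Basis (Matrix (Fin n) (Fin m) F) k (⨂[k] _ : Fin m, MonoidAlgebra k (Fin n → F)) :=
  (Basis.piTensorProduct fun _ : Fin m =>
    (Module.Basis.ofRepr (MonoidAlgebra.coeffLinearEquiv k) :
      Module.Basis (Fin n → F) k (MonoidAlgebra k (Fin n → F)))).reindex
    ((Equiv.piComm fun (_ : Fin m) (_ : Fin n) => F).trans Matrix.of)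

omit [Field F] in
theorem tensorPowerBasis_apply (x : Matrix (Fin n) (Fin m) F) :
    tensorPowerBasis k F n m x =
      PiTensorProduct.tprod k fun j => MonoidAlgebra.single (fun i => x i j) 1 := by
  rw [tensorPowerBasis, Module.Basis.reindex_apply, Basis.piTensorProduct_apply]
  rfl

theorem tensorPowerRep_basis (a : Matrix (Fin n) (Fin n) F) (x : Matrix (Fin n) (Fin m) F) :
    tensorPowerRep k F n m a (tensorPowerBasis k F n m x) = tensorPowerBasis k F n m (a * x) := by
  rw [tensorPowerBasis_apply, tensorPowerBasis_apply]
  change PiTensorProduct.map _ _ = _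
  rw [PiTensorProduct.map_tprod]
  congr 1
  funext j
  rw [Representation.ofMulAction_single]
  rfl

theorem tensorPowerRep_repr_symm (a : Matrix (Fin n) (Fin n) F)
    (f : Matrix (Fin n) (Fin m) F →₀ k) :
    tensorPowerRep k F n m a ((tensorPowerBasis k F n m).repr.symm f) =
      (tensorPowerBasis k F n m).repr.symm (conv (matSingle k a) f) := by
  induction f using Finsupp.induction_linear with
  | zero => simp
  | add f g hf hg => simp only [map_add, hf, hg]
  | single x s =>
    rw [conv_single_single, one_mul, Module.Basis.repr_symm_single, Module.Basis.repr_symm_single,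
      map_smul, tensorPowerRep_basis]

end TensorPower

/-! ### Counting -/

section Counting

variable {F : Type*} [Field F] [Finite F] {n m r : ℕ}

omit [Finite F] in
theorem exists_eq_frameMatrix_mul_GL (u : Matrix (Fin n) (Fin r) F) (hu : u.rank = r) :
    ∃ (W : Subspaces F n r) (g : GL (Fin r) F), u = frameMatrix W * (g : Matrix (Fin r) (Fin r) F) := by
  have : ∀ s, s = u.rank → ∃ (W : Subspaces F n s) (y : Matrix (Fin s) (Fin r) F),
      y.rank = s ∧ u = frameMatrix W * y := by
    rintro _ rfl
    exact exists_eq_frameMatrix_mul u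
  obtain ⟨W, y, hy, h⟩ := this r hu.symm
  exact ⟨W, ((isUnit_iff_rank_eq y).2 hy).unit, h⟩

omit [Finite F] in
/-- Subspaces and invertible matrices parametrise the matrices of full column rank. -/
theorem card_subspaces_mul_card_GL (n r : ℕ) :
    Nat.card (Subspaces F n r) * Nat.card (GL (Fin r) F) =
      Nat.card {u : Matrix (Fin n) (Fin r) F // u.rank = r} := by
  rw [← Nat.card_prod]
  refine Nat.card_congr (Equiv.ofBijective (fun p =>
    ⟨frameMatrix p.1 * (p.2 : Matrix (Fin r) (Fin r) F),
    by rw [rank_frameMatrix_mul, rank_GL]⟩) ⟨?_, ?_⟩)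
  · rintro ⟨U, g⟩ ⟨U', g'⟩ h
    have h' := congrArg Subtype.val h
    obtain rfl := eq_of_frameMatrix_mul_eq (rank_GL g) h'
    exact Prod.ext rfl (Units.ext (frameMatrix_mul_left_injective U h'))
  · rintro ⟨u, hu⟩
    obtain ⟨W, g, h⟩ := exists_eq_frameMatrix_mul_GL u hu
    exact ⟨(W, g), Subtype.ext h.symm⟩

variable (F) in
-- A matrix determines its rank, its row space `U` and the factor `u` in `u A_Uᵀ`. Only the
-- inequality is needed, since surjectivity of the decomposition map supplies the other one.
theorem sum_card_subspaces_le (n m : ℕ) :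
    ∑ r : Fin (min n m + 1),
      Nat.card (Subspaces F n r) * Nat.card (GL (Fin r) F) * Nat.card (Subspaces F m r) ≤
        Nat.card (Matrix (Fin n) (Fin m) F) := by
  have e : ∑ r : Fin (min n m + 1),
      Nat.card (Subspaces F n r) * Nat.card (GL (Fin r) F) * Nat.card (Subspaces F m r) =
      Nat.card (Σ r : Fin (min n m + 1),
        {u : Matrix (Fin n) (Fin r) F // u.rank = r} × Subspaces F m r) := by
    rw [Nat.card_sigma]
    exact Finset.sum_congr rfl fun r _ => by rw [Nat.card_prod, card_subspaces_mul_card_GL]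
  rw [e]
  refine Nat.card_le_card_of_injective
    (fun p => p.2.1.1 * (frameMatrix p.2.2).transpose) ?_
  rintro ⟨r, ⟨u, hu⟩, U⟩ ⟨r', ⟨u', hu'⟩, U'⟩ h
  dsimp only at h
  have hr : r = r' := Fin.ext <| by
    rw [← hu, ← rank_mul_frameMatrix_transpose U, h, rank_mul_frameMatrix_transpose, hu']
  subst hr
  obtain rfl := eq_of_mul_frameMatrix_transpose_eq hu h
  obtain rfl := mul_frameMatrix_transpose_injective U h
  rfl

/-- Such matrices are the linearly independent `r`-tuples of columns in `F^n`. -/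
theorem card_rank_eq (hr : r ≤ n) : Nat.card {u : Matrix (Fin n) (Fin r) F // u.rank = r} =
    ∏ i : Fin r, (Nat.card F ^ n - Nat.card F ^ (i : ℕ)) := by
  have := Fintype.ofFinite F
  have h := card_linearIndependent (K := F) (V := Fin n → F) (k := r) (by simpa using hr)
  rw [Module.finrank_fin_fun, ← Nat.card_eq_fintype_card] at h
  rw [← h]
  refine Nat.card_congr
    ((Matrix.of.symm.trans (Equiv.piComm fun (_ : Fin n) (_ : Fin r) => F)).subtypeEquiv fun u => ?_)
  rw [linearIndependent_iff_card_eq_finrank_span, Fintype.card_fin, Matrix.rank_eq_finrank_span_cols]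
  exact eq_comm

theorem qInt_mul (q : ℚ) (i : ℕ) : qInt q i * (q - 1) = q ^ i - 1 := geom_sum_mul q i

theorem qFactorial_split (q : ℚ) {r m : ℕ} (hr : r ≤ m) :
    qFactorial q m = qFactorial q (m - r) * ∏ i ∈ Finset.range r, qInt q (m - i) := by
  induction r with
  | zero => simp
  | succ r ih =>
    rw [ih (by omega), Finset.prod_range_succ, show m - r = m - (r + 1) + 1 by omega, qFactorial,
      Finset.prod_range_succ, qFactorial]
    ring

theorem qFactorial_pos {q : ℚ} (hq : 0 < q) (m : ℕ) : 0 < qFactorial q m :=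
  Finset.prod_pos fun _ _ => Finset.sum_pos (fun _ _ => pow_pos hq _) ⟨0, by simp⟩

/-- Each factor is `q^m - q^i = q^i (q - 1) [m - i]_q`. -/
theorem prod_pow_sub_pow {q : ℕ} (hq : 1 < q) (hr : r ≤ m) :
    ((∏ i : Fin r, (q ^ m - q ^ (i : ℕ)) : ℕ) : ℚ) * qFactorial q (m - r) =
      (∏ i ∈ Finset.range r, (q : ℚ) ^ i * (q - 1)) * qFactorial q m := by
  rw [Fin.prod_univ_eq_prod_range (fun i => q ^ m - q ^ i), qFactorial_split _ hr, Nat.cast_prod,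
    mul_left_comm, mul_comm, ← Finset.prod_mul_distrib]
  congr 1
  refine Finset.prod_congr rfl fun i hi => ?_
  have him : i ≤ m := (Finset.mem_range.1 hi).le.trans hr
  rw [mul_assoc, mul_comm _ (qInt _ _), qInt_mul, mul_sub, ← pow_add, Nat.add_sub_of_le him,
    mul_one, Nat.cast_sub (Nat.pow_le_pow_right (by omega) him), Nat.cast_pow, Nat.cast_pow]

theorem card_subspaces (hr : r ≤ m) :
    (Nat.card (Subspaces F m r) : ℚ) = qBinom (Nat.card F) m r := by
  have hq : 1 < Nat.card F := Finite.one_lt_card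
  have hq0 : (0 : ℚ) < Nat.card F := by exact_mod_cast (zero_lt_one.trans hq)
  have hq1 : (1 : ℚ) < Nat.card F := by exact_mod_cast hq
  have := Fintype.ofFinite F
  have h := card_subspaces_mul_card_GL (F := F) m r
  rw [card_rank_eq hr, Matrix.card_GL_field, ← Nat.card_eq_fintype_card] at h
  have h' := congrArg (Nat.cast : ℕ → ℚ) h
  rw [Nat.cast_mul] at h'
  have h1 := prod_pow_sub_pow hq hr
  -- The case `m = r` computes `|GL_r|`; the product `∏ q^i (q - 1)` is common to both counts and
  -- cancels.
  have h2 := prod_pow_sub_pow hq (le_refl r)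
  have hC : (∏ i ∈ Finset.range r, (Nat.card F : ℚ) ^ i * (Nat.card F - 1)) ≠ 0 :=
    Finset.prod_ne_zero_iff.2 fun i _ => mul_ne_zero (pow_pos hq0 _).ne' (by linarith)
  rw [Nat.sub_self, show qFactorial (Nat.card F) 0 = 1 by simp [qFactorial], mul_one] at h2
  rw [← h', h2] at h1
  rw [qBinom, eq_div_iff (mul_pos (qFactorial_pos hq0 _) (qFactorial_pos hq0 _)).ne']
  refine mul_left_cancel₀ hC ?_
  rw [← h1]
  ring

end Counting

/-! ### The decomposition -/

section Main

/-- A surjection from a double direct sum onto a space of at least its dimension is bijective. -/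
theorem bijective_of_surjective_directSum {k A ι T : Type*} {κ : ι → Type*} [Field k] [Ring A]
    [Algebra k A] [Fintype ι] [∀ i, Fintype (κ i)] (M : ∀ i, κ i → Type*)
    [∀ i j, AddCommGroup (M i j)] [∀ i j, Module k (M i j)] [∀ i j, Module A (M i j)]
    [∀ i j, IsScalarTower k A (M i j)] [∀ i j, Module.Finite k (M i j)] [AddCommGroup T]
    [Module k T] [Module A T] [IsScalarTower k A T] [Module.Finite k T]
    (f : (⨁ (i : ι) (j : κ i), M i j) →ₗ[A] T) (hf : Function.Surjective f)
    (h : ∑ i, ∑ j, Module.finrank k (M i j) ≤ Module.finrank k T) : Function.Bijective f := by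
  classical
  let g : (⨁ (i : ι) (j : κ i), M i j) →ₗ[k] T :=
    { toFun := f
      map_add' := f.map_add
      map_smul' := fun c x => by
        rw [← algebraMap_smul A c x, map_smul, algebraMap_smul, RingHom.id_apply] }
  have e : Module.finrank k (⨁ (i : ι) (j : κ i), M i j) = ∑ i, ∑ j, Module.finrank k (M i j) := by
    simp only [Module.finrank_directSum]
  have heq := le_antisymm (e.trans_le h) (LinearMap.finrank_le_finrank_of_surjective (f := g) hf)
  exact ⟨(LinearMap.injective_iff_surjective_of_finrank_eq_finrank (f := g) heq).2 hf, hf⟩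

variable {k : Type*} [Field k] {F : Type*} [Field F] [Finite F]

theorem finrank_LSpace {r : ℕ} (n : ℕ) (π : IrrRep k (GL (Fin r) F)) :
    Module.finrank k (LSpace n π) = Nat.card (Subspaces F n r) * Module.finrank k π.V := by
  rw [Module.finrank_tensorProduct, Module.finrank_finsupp_self, Nat.card_eq_fintype_card, mul_comm]

variable [IsAlgClosed k] [CharZero k]

/-- A top element of size `r`. -/
def topElement (k : Type*) [Field k] [IsAlgClosed k] [CharZero k] (F : Type*) [Field F] [Finite F]
    (r : ℕ) : Matrix (Fin r) (Fin r) F →₀ k :=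
  (exists_isTopElement k F r).choose

theorem isTopElement_topElement (r : ℕ) : IsTopElement (topElement k F r) :=
  (exists_isTopElement k F r).choose_spec

/-- The index set of the copies of `L_n(π)` in `V^{⊗m}`. -/
def copyEquiv {r : ℕ} (m : ℕ) (c : IrrClass k (GL (Fin r) F)) :
    Fin (Module.finrank k (LSpace m c.rep)) ≃
      Subspaces F m r × Fin (Module.finrank k c.rep.V) :=
  (Fintype.equivFinOfCardEq (by
    rw [finrank_LSpace, Fintype.card_prod, Fintype.card_fin, Nat.card_eq_fintype_card])).symm

/-- The embedding of a copy of `L_n(π)` into `V^{⊗m}`. -/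
def copyEmbedding (n m : ℕ) {r : ℕ} (c : IrrClass k (GL (Fin r) F)) (U : Subspaces F m r)
    (l : Fin (Module.finrank k c.rep.V)) :
    (LRep n c.rep).asModule →ₗ[MonoidAlgebra k (Matrix (Fin n) (Fin n) F)]
      (tensorPowerRep k F n m).asModule :=
  Representation.IntertwiningMap.equivLinearMapAsModule (LRep n c.rep) (tensorPowerRep k F n m)
    { toLinearMap := (tensorPowerBasis k F n m).repr.symm.toLinearMap ∘ₗ
        LEmbedding c.rep (regularEmbedding c l) (topElement k F r) U
      isIntertwining' := fun a => LinearMap.ext fun x => by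
        change (tensorPowerBasis k F n m).repr.symm (LEmbedding _ _ _ U (LAction n c.rep a x)) =
          tensorPowerRep k F n m a ((tensorPowerBasis k F n m).repr.symm _)
        rw [LEmbedding_LAction _ _ (regularEmbedding_apply c l) (isTopElement_topElement r),
          tensorPowerRep_repr_symm] }

open Classical in
variable (k F) in
/-- The decomposition map of `V^{⊗m}`. -/
def decompositionMap (n m : ℕ) :
    (⨁ (r : Fin (min n m + 1)) (c : IrrClass k (GL (Fin r) F)),
      (Fin (Module.finrank k (LSpace m c.rep)) → (LRep n c.rep).asModule))
      →ₗ[MonoidAlgebra k (Matrix (Fin n) (Fin n) F)] (tensorPowerRep k F n m).asModule :=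
  DirectSum.toModule _ _ _ fun _ => DirectSum.toModule _ _ _ fun c =>
    ∑ i, copyEmbedding n m c (copyEquiv m c i).1 (copyEquiv m c i).2 ∘ₗ LinearMap.proj i

theorem copyEmbedding_mem_range (n m : ℕ) (r : Fin (min n m + 1)) (c : IrrClass k (GL (Fin r) F))
    (U : Subspaces F m r) (l : Fin (Module.finrank k c.rep.V)) (x : (LRep n c.rep).asModule) :
    copyEmbedding n m c U l x ∈ LinearMap.range (decompositionMap k F n m) := by
  classical
  let i := (copyEquiv m c).symm (U, l)
  refine ⟨DirectSum.lof (MonoidAlgebra k (Matrix (Fin n) (Fin n) F)) _ _ r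
    (DirectSum.lof (MonoidAlgebra k (Matrix (Fin n) (Fin n) F)) _ _ c (Pi.single i x)), ?_⟩
  rw [decompositionMap, DirectSum.toModule_lof, DirectSum.toModule_lof, LinearMap.sum_apply,
    Finset.sum_eq_single i]
  · simp [i]
  · intro j _ hj
    simp [hj]
  · simp

theorem decompositionMap_surjective (n m : ℕ) :
    Function.Surjective (decompositionMap k F n m) := by
  let X : Submodule k (Matrix (Fin n) (Fin m) F →₀ k) :=
    ((LinearMap.range (decompositionMap k F n m)).restrictScalars k).comap
      (tensorPowerBasis k F n m).repr.symm.toLinearMap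
  have hX : ∀ x, matSingle k x ∈ X := fun x => by
    refine matSingle_mem_of_rank_lt (N := min n m + 1) (topElement k F)
      (fun s _ => isTopElement_topElement s) X (fun s hs U u hu => ?_) x ?_
    -- Writing `u = A_W g` and splitting `g` along the regular representation exhibits `u ε_s A_Uᵀ`
    -- as a sum of values of the embeddings.
    · obtain ⟨W, g, rfl⟩ := exists_eq_frameMatrix_mul_GL u hu
      have := Fintype.ofFinite (IrrClass k (GL (Fin s) F))
      obtain ⟨v, hv⟩ := exists_eq_sum_regularEmbedding (k := k) (MonoidAlgebra.single g 1)
      have h1 : matSingle k (frameMatrix W * (g : Matrix (Fin s) (Fin s) F)) =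
          conv (matSingle k (frameMatrix W)) (ofGroupAlgebra k F s (MonoidAlgebra.single g 1)) := by
        rw [ofGroupAlgebra_single, conv_single_single, one_mul]
      rw [h1, hv]
      simp only [map_sum, LinearMap.sum_apply, ← LEmbedding_tmul_single]
      refine Submodule.sum_mem _ fun c _ => Submodule.sum_mem _ fun l _ => ?_
      exact copyEmbedding_mem_range n m ⟨s, hs⟩ c U l _
    · exact Nat.lt_succ_of_le (le_min x.rank_le_height x.rank_le_width)
  intro y
  obtain ⟨f, rfl⟩ := (tensorPowerBasis k F n m).repr.symm.surjective y
  suffices f ∈ X from this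
  rw [← Finsupp.sum_single f]
  refine Submodule.sum_mem _ fun x _ => ?_
  rw [← Finsupp.smul_single_one]
  exact Submodule.smul_mem _ _ (hX x)

theorem decompositionMap_bijective (n m : ℕ) :
    Function.Bijective (decompositionMap k F n m) := by
  classical
  have hfin : ∀ r, Fintype (IrrClass k (GL (Fin r) F)) := fun r => Fintype.ofFinite _
  have hs := decompositionMap_surjective (k := k) (F := F) n m
  have hL : ∀ (r : ℕ) (c : IrrClass k (GL (Fin r) F)),
      Module.Finite k (LRep n c.rep).asModule := fun r c =>
    Module.Finite.equiv (LRep n c.rep).asModuleEquiv.symm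
  have := Fintype.ofFinite (Matrix (Fin n) (Fin m) F)
  have hT : Module.Finite k (tensorPowerRep k F n m).asModule :=
    Module.Finite.equiv ((tensorPowerBasis k F n m).repr.symm ≪≫ₗ
      (tensorPowerRep k F n m).asModuleEquiv.symm)
  have H := bijective_of_surjective_directSum (k := k)
    (A := MonoidAlgebra k (Matrix (Fin n) (Fin n) F)) (T := (tensorPowerRep k F n m).asModule)
    (fun (r : Fin (min n m + 1)) (c : IrrClass k (GL (Fin r) F)) =>
      (Fin (Module.finrank k (LSpace m c.rep)) → (LRep n c.rep).asModule))
  refine H (decompositionMap k F n m) hs ?_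
  rw [((tensorPowerRep k F n m).asModuleEquiv ≪≫ₗ (tensorPowerBasis k F n m).repr).finrank_eq,
    Module.finrank_finsupp_self, ← Nat.card_eq_fintype_card]
  refine le_trans (Finset.sum_le_sum fun r _ => ?_) (sum_card_subspaces_le F n m)
  -- One factor `dim π` comes from the multiplicity, the other from `L_n(π)` itself; their products
  -- sum to `|GL_r|`.
  rw [← sum_finrank_sq k (GL (Fin r) F), Finset.mul_sum, Finset.sum_mul]
  refine Finset.sum_le_sum fun c _ => ?_
  rw [Module.finrank_pi_fintype, Finset.sum_const, Finset.card_univ, Fintype.card_fin,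
    (LRep n c.rep).asModuleEquiv.finrank_eq, finrank_LSpace, finrank_LSpace, smul_eq_mul]
  apply le_of_eq
  ring

end Main
end

theorem mainTheorem10 {k : Type*} [Field k] [IsAlgClosed k] [CharZero k]
    {F : Type*} [Field F] [Finite F] (n m : ℕ) :
    Nonempty ((tensorPowerRep k F n m).asModule
      ≃ₗ[MonoidAlgebra k (Matrix (Fin n) (Fin n) F)]
        ⨁ (r : Fin (min n m + 1)) (c : IrrClass k (GL (Fin r) F)),
          (Fin (Module.finrank k (LSpace m c.rep)) → (LRep n c.rep).asModule)) ∧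
    ∀ (r : Fin (min n m + 1)) (c : IrrClass k (GL (Fin r) F)),
      (Module.finrank k (LSpace m c.rep) : ℚ) =
        qBinom (Nat.card F) m r * Module.finrank k c.rep.V := by
  refine ⟨⟨(LinearEquiv.ofBijective _ (decompositionMap_bijective n m)).symm⟩, fun r c => ?_⟩
  have hr : (r : ℕ) ≤ m := (Nat.lt_succ_iff.1 r.2).trans (min_le_right _ _)
  rw [finrank_LSpace, Nat.cast_mul, card_subspaces hr]
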